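/- Let $\mathcal E$ be a complex Hilbert space, $\mathbb D$ the open unit disc, and $H^2_{\mathcal E}(\mathbb D)$ the Hilbert space of functions $f(z)=\sum_{n\ge 0} a_n z^n$ on $\mathbb D$ with $a_n\in\mathcal E$ and $\|f\|^2=\sum_n\|a_n\|^2<\infty$. Let $T_z$ be the operator $(T_zf)(w)=wf(w)$ on $H^2_{\mathcal E}(\mathbb D)$. Let $\Theta\in H^\infty_{\mathcal B(\mathcal E)}(\mathbb D)$ be an inner multiplier, that is, a bounded holomorphic function $\Theta:\mathbb D\to\mathcal B(\mathcal E)$ whose boundary values $\Theta(e^{i\theta})=\lim_{r\to1^-}\Theta(re^{i\theta})$ (limits in the strong operator topology) exist and are isometries on $\mathcal E$ for almost every $\theta$. Put $$\mathcal Q_\Theta=H^2_{\mathcal E}(\mathbb D)\ominus\Theta H^2_{\mathcal E}(\mathbb D),\qquad S_\Theta=P_{\mathcal Q_\Theta}T_z|_{\mathcal Q_\Theta}\in\mathcal B(\mathcal Q_\Theta),$$ where $P_{\mathcal Q_\Theta}$ is the orthogonal projection of $H^2_{\mathcal E}(\mathbb D)$ onto $\mathcal Q_\Theta$. Assume that $\Theta(e^{i\theta})$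 is invertible in $\mathcal B(\mathcal E)$ for almost every $\theta$, and let $T\in\mathcal B(\mathcal Q_\Theta)$. Then $S_\Theta^*TS_\Theta=T$ if and only if $T=0$. -/

import Mathlib

open scoped Topology Complex.UnitDisc

noncomputable section

namespace ModelSpace

variable (E : Type*) [NormedAddCommGroup E] [InnerProductSpace ℂ E]

/-- `IsTaylor a f`: the function `f` on the open unit disc is the sum of the power series with
coefficients `a 0, a 1, …`, and these coefficients are square-summable in norm. -/
def IsTaylor {E : Type*} [NormedAddCommGroup E] [InnerProductSpace ℂ E]
    (a : ℕ → E) (f : 𝔻 → E) : Prop :=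
  Summable (fun n => ‖a n‖ ^ 2) ∧ ∀ z : 𝔻, HasSum (fun n => (z : ℂ) ^ n • a n) (f z)

variable {E} in
theorem IsTaylor.memℓp {a : ℕ → E} {f : 𝔻 → E} (h : IsTaylor a f) : Memℓp a 2 :=
  memℓp_gen (by simpa using h.1)

variable {E} in
theorem summable_taylor [CompleteSpace E] (a : lp (fun _ : ℕ => E) 2) (z : 𝔻) :
    Summable (fun n => (z : ℂ) ^ n • a n) := by
  refine Summable.of_norm_bounded
    (g := fun n => ‖(z : ℂ)‖ ^ n * ‖a‖)
    ((summable_geometric_of_lt_one (norm_nonneg _) z.norm_lt_one).mul_right _) fun n => ?_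
  rw [norm_smul, norm_pow]
  exact mul_le_mul_of_nonneg_left (lp.norm_apply_le_norm (by norm_num) a n) (by positivity)

variable {E} in
theorem IsTaylor.add {a b : ℕ → E} {f g : 𝔻 → E} (h : IsTaylor a f) (k : IsTaylor b g) :
    IsTaylor (a + b) (f + g) :=
  ⟨by simpa using (h.memℓp.add k.memℓp).summable (by norm_num), fun z => by
    simpa [smul_add] using (h.2 z).add (k.2 z)⟩

variable {E} in
theorem IsTaylor.smul {a : ℕ → E} {f : 𝔻 → E} (c : ℂ) (h : IsTaylor a f) :
    IsTaylor (c • a) (c • f) :=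
  ⟨by simpa [norm_smul, mul_pow] using h.1.mul_left (‖c‖ ^ 2), fun z => by
    simpa [smul_comm c] using (h.2 z).const_smul c⟩

variable {E} in
/-- Uniqueness of Taylor coefficients. -/
theorem IsTaylor.unique {a b : ℕ → E} {f : 𝔻 → E} (h : IsTaylor a f) (k : IsTaylor b f) :
    a = b := by
  have key : ∀ c : ℕ → E, IsTaylor c f → HasFPowerSeriesAt
      (fun z : ℂ => if hz : ‖z‖ < 1 then f (.mk z hz) else 0)
      ((fun n => ContinuousMultilinearMap.mkPiRing ℂ (Fin n) (c n) :) :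
        FormalMultilinearSeries ℂ ℂ E) 0 := by
    intro c hc
    refine hasFPowerSeriesAt_iff.2 ?_
    filter_upwards [Metric.ball_mem_nhds (0 : ℂ) one_pos] with z hz
    have hz' : ‖z‖ < 1 := by simpa using hz
    simpa [hz', FormalMultilinearSeries.coeff] using hc.2 (.mk z hz')
  have := (key a h).eq_formalMultilinearSeries (key b k)
  funext n
  have h2 := congrArg (fun p : FormalMultilinearSeries ℂ ℂ E => p.coeff n) this
  simpa [FormalMultilinearSeries.coeff] using h2

/-- The functions `f : 𝔻 → E` of the form `f z = ∑ zⁿ aₙ` with `∑ ‖aₙ‖² < ∞`. -/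
def hardySubmodule : Submodule ℂ (𝔻 → E) where
  carrier := {f | ∃ a : ℕ → E, IsTaylor a f}
  add_mem' := by
    rintro f g ⟨a, ha⟩ ⟨b, hb⟩
    exact ⟨a + b, ha.add hb⟩
  zero_mem' := ⟨0, by simp, fun z => by simp [hasSum_zero]⟩
  smul_mem' := by
    rintro c f ⟨a, ha⟩
    exact ⟨c • a, ha.smul c⟩

/-- The Hardy space `H²_E(𝔻)` of `E`-valued functions on the open unit disc. -/
def HardySpace : Type _ := hardySubmodule E

namespace HardySpace

instance : AddCommGroup (HardySpace E) := inferInstanceAs (AddCommGroup (hardySubmodule E))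

instance : Module ℂ (HardySpace E) := inferInstanceAs (Module ℂ (hardySubmodule E))

instance : CoeFun (HardySpace E) fun _ => 𝔻 → E := ⟨fun f => f.1⟩

variable {E}

@[ext]
theorem ext {f g : HardySpace E} (h : ∀ z, f z = g z) : f = g := Subtype.ext (funext h)

@[simp]
theorem add_apply (f g : HardySpace E) (z : 𝔻) : (f + g) z = f z + g z := rfl

@[simp]
theorem smul_apply (c : ℂ) (f : HardySpace E) (z : 𝔻) : (c • f) z = c • f z := rfl

@[simp]
theorem zero_apply (z : 𝔻) : (0 : HardySpace E) z = 0 := rfl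

/-- The `n`-th Taylor coefficient. -/
def coeff (f : HardySpace E) : ℕ → E := f.2.choose

theorem isTaylor_coeff (f : HardySpace E) : IsTaylor f.coeff f := f.2.choose_spec

variable (E) in
/-- The linear bijection of `H²_E(𝔻)` with `ℓ²(ℕ, E)` that sends a function to its sequence of
Taylor coefficients. -/
def taylor [CompleteSpace E] : HardySpace E ≃ₗ[ℂ] lp (fun _ : ℕ => E) 2 where
  toFun f := ⟨f.coeff, f.isTaylor_coeff.memℓp⟩
  map_add' f g := by
    ext1
    exact (f + g).isTaylor_coeff.unique (f.isTaylor_coeff.add g.isTaylor_coeff)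
  map_smul' c f := by
    ext1
    exact (c • f).isTaylor_coeff.unique (f.isTaylor_coeff.smul c)
  invFun a := ⟨fun z => ∑' n, (z : ℂ) ^ n • a n, a,
    by simpa using (lp.memℓp a).summable (by norm_num), fun z => (summable_taylor a z).hasSum⟩
  left_inv f := by
    ext z
    exact (f.isTaylor_coeff.2 z).tsum_eq
  right_inv a := by
    ext1
    refine (isTaylor_coeff _).unique ⟨?_, fun z => (summable_taylor a z).hasSum⟩
    simpa using (lp.memℓp a).summable (by norm_num)

variable [CompleteSpace E]

@[simp]
theorem taylor_apply (f : HardySpace E) (n : ℕ) : taylor E f n = f.coeff n := rfl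

/-- The norm of `H²_E(𝔻)` is `‖f‖ = (∑ ‖aₙ‖²) ^ (1 / 2)`, where the `aₙ` are the Taylor
coefficients of `f`. -/
instance : NormedAddCommGroup (HardySpace E) :=
  NormedAddCommGroup.induced _ _ (taylor E) (taylor E).injective

theorem norm_def (f : HardySpace E) : ‖f‖ = ‖taylor E f‖ := rfl

/-- The inner product of `H²_E(𝔻)` is `⟪f, g⟫ = ∑ ⟪aₙ, bₙ⟫`, where the `aₙ` and `bₙ` are the
Taylor coefficients of `f` and `g`. -/
instance : InnerProductSpace ℂ (HardySpace E) where
  norm_smul_le c f := by simp only [norm_def, map_smul, norm_smul, le_refl]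
  inner f g := inner ℂ (taylor E f) (taylor E g)
  norm_sq_eq_re_inner f := norm_sq_eq_re_inner (𝕜 := ℂ) (taylor E f)
  conj_inner_symm f g := inner_conj_symm (𝕜 := ℂ) (taylor E f) (taylor E g)
  add_left f g h := by simp only [map_add, inner_add_left]
  smul_left f g c := by simp only [map_smul, inner_smul_left]

theorem inner_def (f g : HardySpace E) : inner ℂ f g = inner ℂ (taylor E f) (taylor E g) := rfl

variable (E) in
/-- `taylor` as an isometric isomorphism. -/
def taylorIsometry : HardySpace E ≃ₗᵢ[ℂ] lp (fun _ : ℕ => E) 2 where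
  toLinearEquiv := taylor E
  norm_map' _ := rfl

instance : CompleteSpace (HardySpace E) :=
  (taylorIsometry E).toIsometryEquiv.completeSpace

theorem norm_sq_of_isTaylor {f : HardySpace E} {a : ℕ → E} (h : IsTaylor a f) :
    ‖f‖ ^ 2 = ∑' n, ‖a n‖ ^ 2 := by
  have h1 := lp.norm_rpow_eq_tsum (p := 2) (by norm_num) (taylor E f)
  rw [norm_def, h.unique f.isTaylor_coeff]
  simpa using h1

end HardySpace

variable {E} in
theorem IsTaylor.shift {a : ℕ → E} {f : 𝔻 → E} (h : IsTaylor a f) :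
    IsTaylor (fun n => Nat.casesOn n 0 a) (fun z : 𝔻 => (z : ℂ) • f z) := by
  refine ⟨(summable_nat_add_iff 1).1 h.1, fun z => ?_⟩
  rw [← hasSum_nat_add_iff' 1]
  simpa [pow_succ', mul_smul] using (h.2 z).const_smul (z : ℂ)

variable [CompleteSpace E]

/-- The operator `T_z` of multiplication by the coordinate function on `H²_E(𝔻)`. -/
def Tz : HardySpace E →L[ℂ] HardySpace E :=
  LinearMap.mkContinuous
    { toFun := fun f => ⟨fun z => (z : ℂ) • f z, _, f.isTaylor_coeff.shift⟩
      map_add' := fun f g => by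
        ext z
        exact smul_add (z : ℂ) (f z) (g z)
      map_smul' := fun c f => by
        ext z
        exact smul_comm (z : ℂ) c (f z) }
    1 fun f => by
      rw [one_mul]
      refine le_of_sq_le_sq ?_ (norm_nonneg _)
      rw [HardySpace.norm_sq_of_isTaylor f.isTaylor_coeff.shift,
        HardySpace.norm_sq_of_isTaylor f.isTaylor_coeff,
        f.isTaylor_coeff.shift.1.tsum_eq_zero_add]
      simp

@[simp]
theorem Tz_apply (f : HardySpace E) (z : 𝔻) : Tz E f z = (z : ℂ) • f z := rfl

variable {E}

/-- `U` is the boundary value `Θ(ζ)` at the point `ζ` of the unit circle: the radial limit of `Θ`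
at `ζ` in the strong operator topology. -/
def HasBoundaryValue (Θ : ℂ → E →L[ℂ] E) (ζ : ℂ) (U : E →L[ℂ] E) : Prop :=
  ∀ η : E, Filter.Tendsto (fun r : ℝ => Θ (r * ζ) η) (𝓝[<] 1) (𝓝 (U η))

/-- `Θ` belongs to `H^∞_{B(E)}(𝔻)`: it is a bounded holomorphic function on the open unit disc
with values in `B(E)`.  (Its values outside the disc play no role.) -/
structure IsHInfty (Θ : ℂ → E →L[ℂ] E) : Prop where
  differentiableOn : DifferentiableOn ℂ Θ (Metric.ball 0 1)
  bounded : ∃ C : ℝ, ∀ z ∈ Metric.ball (0 : ℂ) 1, ‖Θ z‖ ≤ C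

/-- `Θ` is an inner multiplier: it belongs to `H^∞_{B(E)}(𝔻)` and its boundary values
`Θ(e^{iθ})` are isometries for almost every `θ`. -/
structure IsInner (Θ : ℂ → E →L[ℂ] E) : Prop extends IsHInfty Θ where
  isometry : ∀ᵐ θ : ℝ, ∃ U : E →L[ℂ] E,
    HasBoundaryValue Θ (Complex.exp (θ * Complex.I)) U ∧ ∀ η, ‖U η‖ = ‖η‖

/-- The submodule `Θ H²_E(𝔻)` of `H²_E(𝔻)`, for pointwise multiplication on the disc. -/
def rangeMul (Θ : ℂ → E →L[ℂ] E) : Submodule ℂ (HardySpace E) where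
  carrier := {g | ∃ f : HardySpace E, ∀ z : 𝔻, g z = Θ z (f z)}
  add_mem' := by
    rintro g₁ g₂ ⟨f₁, h₁⟩ ⟨f₂, h₂⟩
    exact ⟨f₁ + f₂, fun z => by simp [h₁, h₂]⟩
  zero_mem' := ⟨0, fun z => by simp⟩
  smul_mem' := by
    rintro c g ⟨f, h⟩
    exact ⟨c • f, fun z => by simp [h]⟩

/-- The model space `Q_Θ = H²_E(𝔻) ⊖ Θ H²_E(𝔻)`. -/
def modelSpace (Θ : ℂ → E →L[ℂ] E) : Submodule ℂ (HardySpace E) := (rangeMul Θ)ᗮ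

instance (Θ : ℂ → E →L[ℂ] E) : CompleteSpace (modelSpace Θ) :=
  inferInstanceAs (CompleteSpace (rangeMul Θ)ᗮ)

/-- The model operator `S_Θ = P_{Q_Θ} T_z|_{Q_Θ}`, the compression of `T_z` to `Q_Θ`. -/
def modelOperator (Θ : ℂ → E →L[ℂ] E) : modelSpace Θ →L[ℂ] modelSpace Θ :=
  (modelSpace Θ).orthogonalProjectionOnto ∘L Tz E ∘L (modelSpace Θ).subtypeL

end ModelSpace

end

/-! If `S` is the model operator and `S* T S = T`, then `⟪x, T y⟫ = ⟪Sⁿ x, T Sⁿ y⟫` for every `n`,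
so `T = 0` as soon as `Sⁿ → 0` strongly (`eq_zero_of_adjoint_comp_comp_eq`). All the work goes into
this strong stability.

Let `P` be the projection onto the model space. Since `Θ H²` is invariant under `T_z`, `Sⁿ P = P
T_zⁿ` (from `modelOperator_projection`). As these operators are contractions and polynomials are
dense, it is enough that `P (zⁿ η) → 0` for each vector `η`.

Write `Θ = ∑ zᵏ Θₖ`. The polynomial `p = ∑_{j ≤ n} zʲ Θ_{n-j}* η` satisfies `⟪zⁿ η, Θ p⟫ = ‖p‖² = ‖Θ
p‖²`, the last equality because `Θ` is inner. Hence `‖zⁿ η - Θ p‖² = ‖η‖² - ∑_{k ≤ n} ‖Θₖ* η‖²`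
(`IsInner.exists_mem_rangeMul_norm_sub_sq`). Invertibility enters only in
`IsInner.norm_sq_le_tsum_adjoint`: an invertible isometry is unitary, so Parseval for `z ↦ Θ(z̄)* η`
gives `∑ ‖Θₖ* η‖² ≥ ‖η‖²`, and the distances tend to zero. -/

open scoped Topology Complex.UnitDisc

noncomputable section

namespace ModelSpace

/-! ### Parseval's formula for vector-valued power series on circles. -/

section Parseval

variable {F : Type*} [NormedAddCommGroup F] [InnerProductSpace ℂ F]

theorem integral_inner_exp_pow_smul (m n : ℕ) (x y : F) :
    ∫ θ : ℝ in -Real.pi..Real.pi, inner ℂ (Complex.exp (θ * Complex.I) ^ m • x)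
      (Complex.exp (θ * Complex.I) ^ n • y) = if m = n then 2 * Real.pi * inner ℂ x y else 0 := by
  have h : ∀ θ : ℝ, inner ℂ (Complex.exp (θ * Complex.I) ^ m • x)
      (Complex.exp (θ * Complex.I) ^ n • y) =
      Complex.exp ((((n : ℂ) - m) * Complex.I) * θ) * inner ℂ x y := by
    intro θ
    rw [inner_smul_left, inner_smul_right, ← mul_assoc]
    congr 1
    rw [← Complex.exp_nat_mul, ← Complex.exp_nat_mul, ← Complex.exp_conj, ← Complex.exp_add]
    congr 1
    simp
    ring
  simp only [h]
  rw [intervalIntegral.integral_mul_const]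
  split_ifs with hmn
  · subst hmn
    simp only [sub_self, zero_mul, Complex.exp_zero, intervalIntegral.integral_const,
      sub_neg_eq_add, ← two_mul, Complex.real_smul, mul_one]
    push_cast
    rfl
  · have hc : ((n : ℂ) - m) ≠ 0 := sub_ne_zero.2 (by exact_mod_cast Ne.symm hmn)
    rw [integral_exp_mul_complex (mul_ne_zero hc Complex.I_ne_zero)]
    have : Complex.exp (((n : ℂ) - m) * Complex.I * (Real.pi : ℝ)) =
        Complex.exp (((n : ℂ) - m) * Complex.I * ((-Real.pi : ℝ) : ℝ)) := by
      rw [Complex.exp_eq_exp_iff_exists_int]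
      exact ⟨(n : ℤ) - m, by push_cast; ring⟩
    rw [this]
    simp

theorem norm_exp_pow_smul (θ : ℝ) (n : ℕ) (x : F) :
    ‖Complex.exp (θ * Complex.I) ^ n • x‖ = ‖x‖ := by
  rw [norm_smul, norm_pow, Complex.norm_exp_ofReal_mul_I, one_pow, one_mul]

/-- Parseval's formula for an absolutely convergent Fourier series of analytic type. -/
theorem integral_norm_sq_of_summable [CompleteSpace F] {a : ℕ → F} (ha : Summable fun n => ‖a n‖) :
    HasSum (fun n => 2 * Real.pi * ‖a n‖ ^ 2) (∫ θ : ℝ in -Real.pi..Real.pi,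
      ‖∑' n, Complex.exp (θ * Complex.I) ^ n • a n‖ ^ 2) := by
  set G : ℝ → F := fun θ => ∑' n, Complex.exp (θ * Complex.I) ^ n • a n with hG
  have hsum : ∀ θ : ℝ, HasSum (fun n => Complex.exp (θ * Complex.I) ^ n • a n) (G θ) := fun θ =>
    (Summable.of_norm (by simpa only [norm_exp_pow_smul] using ha)).hasSum
  have hcont : Continuous G :=
    continuous_tsum (fun n => by fun_prop) ha fun n θ => (norm_exp_pow_smul θ n (a n)).le
  have hbd : ∀ θ, ‖G θ‖ ≤ ∑' n, ‖a n‖ := fun θ =>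
    tsum_of_norm_bounded ha.hasSum fun n => (norm_exp_pow_smul θ n (a n)).le
  -- Only the left slot is expanded here; orthogonality leaves the single term `m = n`. The right
  -- slot is expanded in `h2`.
  have hin : ∀ n, ∫ θ : ℝ in -Real.pi..Real.pi,
      inner ℂ (G θ) (Complex.exp (θ * Complex.I) ^ n • a n) = 2 * Real.pi * (‖a n‖ : ℂ) ^ 2 := by
    intro n
    have h1 : HasSum (fun m => ∫ θ : ℝ in -Real.pi..Real.pi,
        inner ℂ (Complex.exp (θ * Complex.I) ^ m • a m) (Complex.exp (θ * Complex.I) ^ n • a n))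
        (∫ θ : ℝ in -Real.pi..Real.pi,
          inner ℂ (G θ) (Complex.exp (θ * Complex.I) ^ n • a n)) := by
      refine intervalIntegral.hasSum_integral_of_dominated_convergence
        (fun m _ => ‖a m‖ * ‖a n‖) (fun m => ?_) (fun m => ?_) ?_ ?_ ?_
      · exact Continuous.aestronglyMeasurable (by fun_prop)
      · refine .of_forall fun θ _ => (norm_inner_le_norm _ _).trans ?_
        rw [norm_exp_pow_smul, norm_exp_pow_smul]
      · exact .of_forall fun θ _ => ha.mul_right _
      · exact intervalIntegrable_const
      · refine .of_forall fun θ _ => ?_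
        have := (hsum θ).mapL ((innerSL ℂ).flip (Complex.exp (θ * Complex.I) ^ n • a n))
        simpa only [ContinuousLinearMap.flip_apply, innerSL_apply_apply] using this
    refine h1.unique ?_
    simp only [integral_inner_exp_pow_smul]
    convert hasSum_ite_eq n (2 * Real.pi * inner ℂ (a n) (a n) : ℂ) using 1
    · funext m
      split_ifs with h
      · rw [h]
      · rfl
    · rw [inner_self_eq_norm_sq_to_K]
      rfl
  have h2 : HasSum (fun n => ∫ θ : ℝ in -Real.pi..Real.pi,
        inner ℂ (G θ) (Complex.exp (θ * Complex.I) ^ n • a n))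
        (∫ θ : ℝ in -Real.pi..Real.pi, inner ℂ (G θ) (G θ)) := by
    refine intervalIntegral.hasSum_integral_of_dominated_convergence
      (fun n _ => (∑' m, ‖a m‖) * ‖a n‖) (fun m => ?_) (fun m => ?_) ?_ ?_ ?_
    · exact Continuous.aestronglyMeasurable (by fun_prop)
    · refine .of_forall fun θ _ => (norm_inner_le_norm _ _).trans ?_
      rw [norm_exp_pow_smul]
      exact mul_le_mul_of_nonneg_right (hbd θ) (norm_nonneg _)
    · exact .of_forall fun θ _ => ha.mul_left _
    · exact intervalIntegrable_const
    · exact .of_forall fun θ _ => by simpa using (hsum θ).mapL (innerSL ℂ (G θ))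
  rw [← Complex.hasSum_ofReal, ← intervalIntegral.integral_ofReal]
  convert h2 using 1
  · funext n
    rw [hin n]
    push_cast
    rfl
  · refine intervalIntegral.integral_congr fun θ _ => ?_
    rw [inner_self_eq_norm_sq_to_K]
    push_cast
    rfl

theorem norm_ofReal_mul_exp {r : ℝ} (hr : 0 ≤ r) (θ : ℝ) :
    ‖(r : ℂ) * Complex.exp (θ * Complex.I)‖ = r := by
  rw [norm_mul, Complex.norm_exp_ofReal_mul_I, mul_one, Complex.norm_real, Real.norm_of_nonneg hr]

/-- At a radius `s` with `r < s < 1` the terms are bounded, which leaves a geometric series of ratio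
`r / s`. -/
theorem summable_pow_mul_norm_of_hasSum {a : ℕ → F} {h : ℂ → F}
    (hh : ∀ z : ℂ, ‖z‖ < 1 → HasSum (fun n => z ^ n • a n) (h z)) {r : ℝ} (h0 : 0 ≤ r)
    (h1 : r < 1) : Summable fun n => r ^ n * ‖a n‖ := by
  obtain ⟨s, hrs, hs⟩ := exists_between h1
  have hs0 : 0 < s := h0.trans_lt hrs
  have hsum := (hh (s : ℂ) (by rwa [Complex.norm_real, Real.norm_of_nonneg hs0.le])).summable
  obtain ⟨C, hC⟩ := hsum.tendsto_atTop_zero.norm.bddAbove_range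
  have hC' : ∀ n, s ^ n * ‖a n‖ ≤ C := fun n => by
    have := hC ⟨n, rfl⟩
    simpa [norm_smul, abs_of_pos hs0] using this
  refine Summable.of_nonneg_of_le (fun n => by positivity) (fun n => ?_)
    ((summable_geometric_of_lt_one (div_nonneg h0 hs0.le) ((div_lt_one hs0).2 hrs)).mul_right C)
  calc r ^ n * ‖a n‖ = (r / s) ^ n * (s ^ n * ‖a n‖) := by
        rw [← mul_assoc, ← mul_pow, div_mul_cancel₀ _ hs0.ne']
    _ ≤ (r / s) ^ n * C := mul_le_mul_of_nonneg_left (hC' n) (by positivity)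

/-- Parseval's formula on the circle of radius `r`. -/
theorem hasSum_integral_circle [CompleteSpace F] {a : ℕ → F} {h : ℂ → F}
    (hh : ∀ z : ℂ, ‖z‖ < 1 → HasSum (fun n => z ^ n • a n) (h z)) {r : ℝ} (h0 : 0 ≤ r)
    (h1 : r < 1) : HasSum (fun n => 2 * Real.pi * (r ^ n * ‖a n‖) ^ 2)
      (∫ θ : ℝ in -Real.pi..Real.pi, ‖h (r * Complex.exp (θ * Complex.I))‖ ^ 2) := by
  have hn : ∀ n, ‖(r : ℂ) ^ n • a n‖ = r ^ n * ‖a n‖ := fun n => by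
    rw [norm_smul, norm_pow, Complex.norm_real, Real.norm_of_nonneg h0]
  have := integral_norm_sq_of_summable (a := fun n => (r : ℂ) ^ n • a n)
    (by simpa only [hn] using summable_pow_mul_norm_of_hasSum hh h0 h1)
  simp only [hn] at this
  convert this using 1
  refine intervalIntegral.integral_congr fun θ _ => ?_
  rw [← (hh _ (by rwa [norm_ofReal_mul_exp h0])).tsum_eq]
  simp only [mul_pow, smul_smul, mul_comm]

theorem eventually_mem_Ico_of_nhdsLT_one : ∀ᶠ r : ℝ in 𝓝[<] 1, 0 ≤ r ∧ r < 1 := by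
  filter_upwards [Ioo_mem_nhdsLT (zero_lt_one' ℝ)] with r hr using ⟨hr.1.le, hr.2⟩

/-- The squared means over circles of a function with square-summable coefficients converge to
the squared norm. -/
theorem tendsto_integral_circle [CompleteSpace F] {a : ℕ → F} {h : ℂ → F}
    (hh : ∀ z : ℂ, ‖z‖ < 1 → HasSum (fun n => z ^ n • a n) (h z))
    (ha : Summable fun n => ‖a n‖ ^ 2) :
    Filter.Tendsto (fun r : ℝ => ∫ θ : ℝ in -Real.pi..Real.pi,
      ‖h (r * Complex.exp (θ * Complex.I))‖ ^ 2) (𝓝[<] 1) (𝓝 (2 * Real.pi * ∑' n, ‖a n‖ ^ 2)) := by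
  have h1 : Filter.Tendsto (fun r : ℝ => ∑' n, 2 * Real.pi * (r ^ n * ‖a n‖) ^ 2) (𝓝[<] 1)
      (𝓝 (∑' n, 2 * Real.pi * (1 ^ n * ‖a n‖) ^ 2)) := by
    refine tendsto_tsum_of_dominated_convergence (ha.mul_left (2 * Real.pi)) (fun n => ?_) ?_
    · have : Continuous fun r : ℝ => 2 * Real.pi * (r ^ n * ‖a n‖) ^ 2 := by fun_prop
      exact (this.tendsto 1).mono_left nhdsWithin_le_nhds
    · filter_upwards [eventually_mem_Ico_of_nhdsLT_one] with r ⟨hr0, hr1⟩ n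
      rw [Real.norm_of_nonneg (by positivity)]
      have : r ^ n * ‖a n‖ ≤ ‖a n‖ :=
        mul_le_of_le_one_left (norm_nonneg _) (pow_le_one₀ hr0 hr1.le)
      gcongr
  simp only [one_pow, one_mul, tsum_mul_left] at h1
  refine h1.congr' ?_
  filter_upwards [eventually_mem_Ico_of_nhdsLT_one] with r ⟨hr0, hr1⟩
  rw [← (hasSum_integral_circle hh hr0 hr1).tsum_eq, tsum_mul_left]

/-- The coefficients of a bounded analytic function are square-summable. -/
theorem summable_norm_sq_of_bounded [CompleteSpace F] {a : ℕ → F} {h : ℂ → F}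
    (hh : ∀ z : ℂ, ‖z‖ < 1 → HasSum (fun n => z ^ n • a n) (h z)) {C : ℝ}
    (hC : ∀ z : ℂ, ‖z‖ < 1 → ‖h z‖ ≤ C) : Summable fun n => ‖a n‖ ^ 2 := by
  refine summable_of_sum_le (c := C ^ 2) (fun n => by positivity) fun s => ?_
  have h1 : Filter.Tendsto (fun r : ℝ => ∑ n ∈ s, (r ^ n * ‖a n‖) ^ 2) (𝓝[<] 1)
      (𝓝 (∑ n ∈ s, (1 ^ n * ‖a n‖) ^ 2)) := by
    have : Continuous fun r : ℝ => ∑ n ∈ s, (r ^ n * ‖a n‖) ^ 2 := by fun_prop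
    exact (this.tendsto 1).mono_left nhdsWithin_le_nhds
  simp only [one_pow, one_mul] at h1
  refine le_of_tendsto h1 ?_
  filter_upwards [eventually_mem_Ico_of_nhdsLT_one] with r ⟨hr0, hr1⟩
  have hs := hasSum_integral_circle hh hr0 hr1
  have h2 : ∑ n ∈ s, 2 * Real.pi * (r ^ n * ‖a n‖) ^ 2 ≤ _ :=
    sum_le_hasSum s (fun n _ => by positivity) hs
  have hb := intervalIntegral.norm_integral_le_of_norm_le_const (a := -Real.pi) (b := Real.pi)
    (f := fun θ : ℝ => ‖h (r * Complex.exp (θ * Complex.I))‖ ^ 2) (C := C ^ 2) fun θ _ => by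
      rw [Real.norm_of_nonneg (by positivity)]
      have := hC (r * Complex.exp (θ * Complex.I)) (by rwa [norm_ofReal_mul_exp hr0])
      gcongr
  have h3 := (h2.trans (le_abs_self _)).trans hb
  rw [← Finset.mul_sum, sub_neg_eq_add, ← two_mul, abs_of_pos Real.two_pi_pos, mul_comm] at h3
  exact le_of_mul_le_mul_right h3 Real.two_pi_pos

theorem continuous_circle [CompleteSpace F] {a : ℕ → F} {h : ℂ → F}
    (hh : ∀ z : ℂ, ‖z‖ < 1 → HasSum (fun n => z ^ n • a n) (h z)) {r : ℝ} (h0 : 0 ≤ r)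
    (h1 : r < 1) : Continuous fun θ : ℝ => h (r * Complex.exp (θ * Complex.I)) := by
  have : (fun θ : ℝ => h (r * Complex.exp (θ * Complex.I))) =
      fun θ : ℝ => ∑' n, (r * Complex.exp (θ * Complex.I)) ^ n • a n := by
    funext θ
    exact (hh _ (by rwa [norm_ofReal_mul_exp h0])).tsum_eq.symm
  rw [this]
  refine continuous_tsum (fun n => by fun_prop) (summable_pow_mul_norm_of_hasSum hh h0 h1)
    fun n θ => ?_
  rw [norm_smul, norm_pow, norm_ofReal_mul_exp h0]

end Parseval

/-! ### Taylor coefficients and boundary behaviour of inner functions. -/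

section BoundaryValues

variable {E : Type*} [NormedAddCommGroup E] [InnerProductSpace ℂ E]
  {Θ : ℂ → E →L[ℂ] E}

/-- The `k`-th Taylor coefficient at the origin of an operator-valued function. -/
def operatorCoeff (Θ : ℂ → E →L[ℂ] E) (k : ℕ) : E →L[ℂ] E :=
  (k.factorial : ℂ)⁻¹ • iteratedDeriv k Θ 0

theorem IsHInfty.hasSum [CompleteSpace E] (hΘ : IsHInfty Θ) {z : ℂ} (hz : ‖z‖ < 1) :
    HasSum (fun k => z ^ k • operatorCoeff Θ k) (Θ z) := by
  have := Complex.hasSum_taylorSeries_on_ball hΘ.differentiableOn (mem_ball_zero_iff.2 hz)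
  simpa only [sub_zero, operatorCoeff, smul_comm (z ^ _)] using this

theorem IsHInfty.hasSum_apply [CompleteSpace E] (hΘ : IsHInfty Θ) (η : E) (z : ℂ) (hz : ‖z‖ < 1) :
    HasSum (fun k => z ^ k • operatorCoeff Θ k η) (Θ z η) := by
  simpa using (hΘ.hasSum hz).mapL (ContinuousLinearMap.apply ℂ E η)

/-- The adjoint is conjugate-linear, so conjugating the variable restores analyticity. -/
theorem IsHInfty.hasSum_adjoint_apply [CompleteSpace E] (hΘ : IsHInfty Θ) (η : E) (z : ℂ) (hz : ‖z‖ < 1) :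
    HasSum (fun k => z ^ k • ContinuousLinearMap.adjoint (operatorCoeff Θ k) η)
      (ContinuousLinearMap.adjoint (Θ (starRingEnd ℂ z)) η) := by
  have h1 := hΘ.hasSum (z := starRingEnd ℂ z) (by rwa [RCLike.norm_conj])
  have h2 := h1.map (ContinuousLinearMap.adjoint (𝕜 := ℂ) (E := E) (F := E))
    (ContinuousLinearMap.adjoint (𝕜 := ℂ) (E := E) (F := E)).continuous
  have h3 := h2.mapL (ContinuousLinearMap.apply ℂ E η)
  simpa [Function.comp_def, map_smulₛₗ] using h3

theorem IsHInfty.exists_norm_le (hΘ : IsHInfty Θ) :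
    ∃ C : ℝ, 0 ≤ C ∧ ∀ z : ℂ, ‖z‖ < 1 → ‖Θ z‖ ≤ C := by
  obtain ⟨C, hC⟩ := hΘ.bounded
  have h : ∀ z : ℂ, ‖z‖ < 1 → ‖Θ z‖ ≤ C := fun z hz => hC z (mem_ball_zero_iff.2 hz)
  exact ⟨C, (norm_nonneg _).trans (h 0 (by simp)), h⟩

theorem IsHInfty.summable_norm_sq_apply [CompleteSpace E] (hΘ : IsHInfty Θ) (η : E) :
    Summable fun k => ‖operatorCoeff Θ k η‖ ^ 2 := by
  obtain ⟨C, -, hC⟩ := hΘ.exists_norm_le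
  exact summable_norm_sq_of_bounded (hΘ.hasSum_apply η)
    fun z hz => (Θ z).le_of_opNorm_le (hC z hz) η

theorem IsHInfty.norm_adjoint_apply_le [CompleteSpace E] {C : ℝ} (hC : ∀ z : ℂ, ‖z‖ < 1 → ‖Θ z‖ ≤ C) (η : E)
    (z : ℂ) (hz : ‖z‖ < 1) :
    ‖ContinuousLinearMap.adjoint (Θ (starRingEnd ℂ z)) η‖ ≤ C * ‖η‖ := by
  refine ContinuousLinearMap.le_of_opNorm_le _ ?_ η
  rw [LinearIsometryEquiv.norm_map]
  exact hC _ (by rwa [RCLike.norm_conj])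

theorem IsHInfty.summable_norm_sq_adjoint_apply [CompleteSpace E] (hΘ : IsHInfty Θ) (η : E) :
    Summable fun k => ‖ContinuousLinearMap.adjoint (operatorCoeff Θ k) η‖ ^ 2 := by
  obtain ⟨C, -, hC⟩ := hΘ.exists_norm_le
  exact summable_norm_sq_of_bounded (hΘ.hasSum_adjoint_apply η)
    (IsHInfty.norm_adjoint_apply_le hC η)

theorem HasBoundaryValue.unique {ζ : ℂ} {U V : E →L[ℂ] E} (hU : HasBoundaryValue Θ ζ U)
    (hV : HasBoundaryValue Θ ζ V) : U = V :=
  ContinuousLinearMap.ext fun η => tendsto_nhds_unique (hU η) (hV η)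

/-- At a point where the boundary value is unitary, the radial lower limits of the adjoints are
at least isometric. -/
theorem HasBoundaryValue.tendsto_min_norm_adjoint [CompleteSpace E] {ζ : ℂ} {U : E →L[ℂ] E}
    (hU : HasBoundaryValue Θ ζ U) (hiso : ∀ η, ‖U η‖ = ‖η‖) (hunit : IsUnit U) (η : E) :
    Filter.Tendsto
      (fun r : ℝ => min (‖ContinuousLinearMap.adjoint (Θ (r * ζ)) η‖ ^ 2) (‖η‖ ^ 2))
      (𝓝[<] 1) (𝓝 (‖η‖ ^ 2)) := by
  obtain rfl | hη := eq_or_ne η 0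
  · simp
  have hη' : 0 < ‖η‖ := norm_pos_iff.2 hη
  obtain ⟨u, rfl⟩ := hunit
  -- Strong convergence does not pass to adjoints, so `‖Θ(rζ)* η‖` is only bounded below, by pairing
  -- with `x = U⁻¹ η`: it is at least `|⟪η, Θ(rζ) x⟫| / ‖η‖`, which tends to `‖η‖`. The minimum with
  -- `‖η‖²` turns this lower bound into a limit.
  set x : E := (↑u⁻¹ : E →L[ℂ] E) η
  have hx : (u : E →L[ℂ] E) x = η := by
    rw [← mul_apply_eq_comp, Units.mul_inv, one_apply_eq_self]
  have hxn : ‖x‖ = ‖η‖ := by rw [← hiso x, hx]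
  have h1 : Filter.Tendsto (fun r : ℝ => min ((‖inner ℂ η (Θ (r * ζ) x)‖ / ‖η‖) ^ 2) (‖η‖ ^ 2))
      (𝓝[<] 1) (𝓝 (min ((‖inner ℂ η ((u : E →L[ℂ] E) x)‖ / ‖η‖) ^ 2) (‖η‖ ^ 2))) :=
    (((((tendsto_const_nhds (x := η)).inner (hU x)).norm).div_const ‖η‖).pow 2).min
      tendsto_const_nhds
  have h2 : ‖inner ℂ η ((u : E →L[ℂ] E) x)‖ / ‖η‖ = ‖η‖ := by
    rw [hx, inner_self_eq_norm_sq_to_K, norm_pow, RCLike.norm_ofReal, abs_norm]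
    field_simp
  rw [h2, min_self] at h1
  refine tendsto_of_tendsto_of_tendsto_of_le_of_le h1 tendsto_const_nhds (fun r => ?_)
    fun r => min_le_right _ _
  refine min_le_min_right _ ?_
  gcongr
  rw [div_le_iff₀ hη', ← ContinuousLinearMap.adjoint_inner_left]
  exact (norm_inner_le_norm _ _).trans (by rw [hxn])

/-- If the boundary values of an inner function are unitary, then the adjoints of its Taylor
coefficients form a column that is bounded below by one. -/
theorem IsInner.norm_sq_le_tsum_adjoint [CompleteSpace E] (hΘ : IsInner Θ)
    (hinv : ∀ᵐ θ : ℝ, ∃ U : E →L[ℂ] E,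
      HasBoundaryValue Θ (Complex.exp (θ * Complex.I)) U ∧ IsUnit U) (η : E) :
    ‖η‖ ^ 2 ≤ ∑' k, ‖ContinuousLinearMap.adjoint (operatorCoeff Θ k) η‖ ^ 2 := by
  have hs := hΘ.toIsHInfty.hasSum_adjoint_apply η
  set h : ℂ → E := fun z => ContinuousLinearMap.adjoint (Θ (starRingEnd ℂ z)) η with hh
  have hae : ∀ᵐ θ : ℝ, Filter.Tendsto
      (fun r : ℝ => min (‖h (r * Complex.exp (θ * Complex.I))‖ ^ 2) (‖η‖ ^ 2))
      (𝓝[<] 1) (𝓝 (‖η‖ ^ 2)) := by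
    have h0 : ∀ᵐ θ : ℝ, Filter.Tendsto (fun r : ℝ => min (‖ContinuousLinearMap.adjoint
        (Θ (r * Complex.exp (θ * Complex.I))) η‖ ^ 2) (‖η‖ ^ 2)) (𝓝[<] 1) (𝓝 (‖η‖ ^ 2)) := by
      filter_upwards [hΘ.isometry, hinv] with θ ⟨U, hU, hiso⟩ ⟨V, hV, hunit⟩
      obtain rfl := hU.unique hV
      exact hU.tendsto_min_norm_adjoint hiso hunit η
    -- The conjugation in `h` replaces `θ` by `-θ`, which preserves null sets.
    filter_upwards [(MeasureTheory.Measure.measurePreserving_neg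
      (MeasureTheory.volume : MeasureTheory.Measure ℝ)).quasiMeasurePreserving.ae h0] with θ hθ
    convert hθ using 6 with r
    simp [← Complex.exp_conj]
  have h1 : Filter.Tendsto (fun r : ℝ => ∫ θ : ℝ in -Real.pi..Real.pi,
      min (‖h (r * Complex.exp (θ * Complex.I))‖ ^ 2) (‖η‖ ^ 2)) (𝓝[<] 1)
      (𝓝 (∫ θ : ℝ in -Real.pi..Real.pi, ‖η‖ ^ 2)) := by
    refine intervalIntegral.tendsto_integral_filter_of_dominated_convergence
      (fun _ => ‖η‖ ^ 2) ?_ ?_ intervalIntegrable_const ?_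
    · filter_upwards [eventually_mem_Ico_of_nhdsLT_one] with r ⟨hr0, hr1⟩
      have := continuous_circle hs hr0 hr1
      exact Continuous.aestronglyMeasurable ((this.norm.pow 2).min continuous_const)
    · refine .of_forall fun r => .of_forall fun θ _ => ?_
      rw [Real.norm_of_nonneg (by positivity)]
      exact min_le_right _ _
    · filter_upwards [hae] with θ hθ _ using hθ
  have h2 := tendsto_integral_circle hs (hΘ.toIsHInfty.summable_norm_sq_adjoint_apply η)
  have h3 := le_of_tendsto_of_tendsto h1 h2 (by
    filter_upwards [eventually_mem_Ico_of_nhdsLT_one] with r ⟨hr0, hr1⟩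
    have := continuous_circle hs hr0 hr1
    refine intervalIntegral.integral_mono_on (by linarith [Real.pi_pos])
      (Continuous.intervalIntegrable ((this.norm.pow 2).min continuous_const) _ _)
      (Continuous.intervalIntegrable (this.norm.pow 2) _ _) fun θ _ => min_le_left _ _)
  rw [intervalIntegral.integral_const, sub_neg_eq_add, ← two_mul, smul_eq_mul] at h3
  exact le_of_mul_le_mul_left h3 Real.two_pi_pos

theorem HardySpace.hasSum_of_eqOn (f : HardySpace E) {p : ℂ → E} (hp : ∀ z : 𝔻, f z = p z) (z : ℂ)
    (hz : ‖z‖ < 1) : HasSum (fun n => z ^ n • f.coeff n) (p z) := by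
  have := f.isTaylor_coeff.2 (.mk z hz)
  rwa [hp] at this

/-- Multiplication by an inner function is isometric on functions with a continuous extension to
the closed disc. -/
theorem IsInner.norm_eq_of_forall_apply [CompleteSpace E] (hΘ : IsInner Θ) {f g : HardySpace E} {p : ℂ → E}
    (hp : Continuous p) (hf : ∀ z : 𝔻, f z = p z) (hg : ∀ z : 𝔻, g z = Θ z (p z)) :
    ‖g‖ = ‖f‖ := by
  have hsf := f.hasSum_of_eqOn hf
  have hsg := g.hasSum_of_eqOn (p := fun z => Θ z (p z)) hg
  obtain ⟨C, hC0, hC⟩ := hΘ.toIsHInfty.exists_norm_le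
  obtain ⟨K, hK⟩ := (isCompact_closedBall (0 : ℂ) 1).exists_bound_of_continuousOn hp.continuousOn
  have hK' : ∀ z : ℂ, ‖z‖ < 1 → ‖p z‖ ≤ K := fun z hz => hK z (mem_closedBall_zero_iff.2 hz.le)
  have hlf := tendsto_integral_circle hsf f.isTaylor_coeff.1
  have hlg := tendsto_integral_circle hsg g.isTaylor_coeff.1
  rw [← HardySpace.norm_sq_of_isTaylor f.isTaylor_coeff] at hlf
  rw [← HardySpace.norm_sq_of_isTaylor g.isTaylor_coeff] at hlg
  have hlim : ∀ θ : ℝ, Filter.Tendsto (fun r : ℝ => p (r * Complex.exp (θ * Complex.I))) (𝓝[<] 1)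
      (𝓝 (p (Complex.exp (θ * Complex.I)))) := by
    intro θ
    have : Continuous fun r : ℝ => p (r * Complex.exp (θ * Complex.I)) := by fun_prop
    simpa using (this.tendsto 1).mono_left nhdsWithin_le_nhds
  have hcf : Filter.Tendsto (fun r : ℝ => ∫ θ : ℝ in -Real.pi..Real.pi,
      ‖p (r * Complex.exp (θ * Complex.I))‖ ^ 2) (𝓝[<] 1)
      (𝓝 (∫ θ : ℝ in -Real.pi..Real.pi, ‖p (Complex.exp (θ * Complex.I))‖ ^ 2)) := by
    refine intervalIntegral.tendsto_integral_filter_of_dominated_convergence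
      (fun _ => K ^ 2) ?_ ?_ intervalIntegrable_const ?_
    · exact .of_forall fun r => Continuous.aestronglyMeasurable (by fun_prop)
    · filter_upwards [eventually_mem_Ico_of_nhdsLT_one] with r ⟨hr0, hr1⟩
      refine .of_forall fun θ _ => ?_
      rw [Real.norm_of_nonneg (by positivity)]
      have := hK' _ ((norm_ofReal_mul_exp hr0 θ).trans_lt hr1)
      gcongr
    · exact .of_forall fun θ _ => (hlim θ).norm.pow 2
  have hcg : Filter.Tendsto (fun r : ℝ => ∫ θ : ℝ in -Real.pi..Real.pi,
      ‖Θ (r * Complex.exp (θ * Complex.I)) (p (r * Complex.exp (θ * Complex.I)))‖ ^ 2) (𝓝[<] 1)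
      (𝓝 (∫ θ : ℝ in -Real.pi..Real.pi, ‖p (Complex.exp (θ * Complex.I))‖ ^ 2)) := by
    refine intervalIntegral.tendsto_integral_filter_of_dominated_convergence
      (fun _ => (C * K) ^ 2) ?_ ?_ intervalIntegrable_const ?_
    · filter_upwards [eventually_mem_Ico_of_nhdsLT_one] with r ⟨hr0, hr1⟩
      exact Continuous.aestronglyMeasurable ((continuous_circle hsg hr0 hr1).norm.pow 2)
    · filter_upwards [eventually_mem_Ico_of_nhdsLT_one] with r ⟨hr0, hr1⟩
      refine .of_forall fun θ _ => ?_
      rw [Real.norm_of_nonneg (by positivity)]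
      have hz := (norm_ofReal_mul_exp hr0 θ).trans_lt hr1
      have := (Θ (r * Complex.exp (θ * Complex.I))).le_of_opNorm_le_of_le (hC _ hz) (hK' _ hz)
      gcongr
    · filter_upwards [hΘ.isometry] with θ ⟨U, hU, hiso⟩ _
      refine Filter.Tendsto.pow ?_ 2
      have h1 := hU (p (Complex.exp (θ * Complex.I)))
      -- The strong limit controls `Θ(rζ)` only on the fixed vector `p(ζ)`; the error from `p(rζ) -
      -- p(ζ)` is absorbed by the uniform bound `C`.
      have h2 : Filter.Tendsto (fun r : ℝ => Θ (r * Complex.exp (θ * Complex.I))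
          (p (r * Complex.exp (θ * Complex.I)) - p (Complex.exp (θ * Complex.I)))) (𝓝[<] 1)
          (𝓝 0) := by
        have h3 : Filter.Tendsto (fun r : ℝ => C * ‖p (r * Complex.exp (θ * Complex.I)) -
            p (Complex.exp (θ * Complex.I))‖) (𝓝[<] 1) (𝓝 (C * 0)) :=
          (tendsto_iff_norm_sub_tendsto_zero.1 (hlim θ)).const_mul C
        rw [mul_zero] at h3
        refine squeeze_zero_norm' ?_ h3
        filter_upwards [eventually_mem_Ico_of_nhdsLT_one] with r ⟨hr0, hr1⟩
        exact ContinuousLinearMap.le_of_opNorm_le _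
          (hC _ ((norm_ofReal_mul_exp hr0 θ).trans_lt hr1)) _
      have h4 := (h2.add h1).norm
      rw [zero_add, hiso] at h4
      simpa using h4
  have e1 := tendsto_nhds_unique hlf hcf
  have e2 := tendsto_nhds_unique hlg hcg
  have e3 := mul_left_cancel₀ Real.two_pi_pos.ne' (e2.trans e1.symm)
  exact (pow_left_inj₀ (norm_nonneg _) (norm_nonneg _) two_ne_zero).1 e3

end BoundaryValues

/-! ### Distance from monomials to `Θ H²`, and strong stability of the model operator. -/

section Stability

variable {E : Type*} [NormedAddCommGroup E] [InnerProductSpace ℂ E]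

theorem IsTaylor.pow_smul {a : ℕ → E} {f : 𝔻 → E} (h : IsTaylor a f) (j : ℕ) :
    IsTaylor (fun n => if j ≤ n then a (n - j) else 0) (fun z : 𝔻 => (z : ℂ) ^ j • f z) := by
  induction j with
  | zero => simpa using h
  | succ j ih =>
    convert ih.shift using 1
    · funext n
      cases n <;> simp
    · funext z
      rw [pow_succ', mul_smul]

theorem IsTaylor.sum {ι : Type*} {a : ι → ℕ → E} {f : ι → 𝔻 → E} (s : Finset ι)
    (h : ∀ i ∈ s, IsTaylor (a i) (f i)) : IsTaylor (∑ i ∈ s, a i) (∑ i ∈ s, f i) := by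
  classical
  induction s using Finset.induction_on with
  | empty => exact ⟨by simp, fun z => by simp [hasSum_zero]⟩
  | insert i s hi ih =>
    rw [Finset.sum_insert hi, Finset.sum_insert hi]
    exact (h i (by simp)).add (ih fun k hk => h k (Finset.mem_insert_of_mem hk))

theorem isTaylor_single (n : ℕ) (η : E) :
    IsTaylor (Pi.single n η) (fun z : 𝔻 => (z : ℂ) ^ n • η) := by
  refine ⟨summable_of_ne_finset_zero (s := {n}) fun k hk => ?_, fun z => ?_⟩
  · rw [Pi.single_eq_of_ne (by simpa using hk)]
    simp
  · convert hasSum_single n fun k hk => ?_ using 1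
    · rw [Pi.single_eq_same]
    · rw [Pi.single_eq_of_ne hk, smul_zero]

/-- The function `zⁿ η`. -/
def monomial (n : ℕ) (η : E) : HardySpace E := ⟨fun z => (z : ℂ) ^ n • η, _, isTaylor_single n η⟩

theorem monomial_apply (n : ℕ) (η : E) (z : 𝔻) : monomial n η z = (z : ℂ) ^ n • η := rfl

theorem coeff_monomial (n : ℕ) (η : E) : (monomial n η).coeff = Pi.single n η :=
  (monomial n η).isTaylor_coeff.unique (isTaylor_single n η)

variable [CompleteSpace E]

theorem taylor_monomial (n : ℕ) (η : E) :
    HardySpace.taylor E (monomial n η) = lp.single 2 n η := by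
  ext k
  rw [HardySpace.taylor_apply, coeff_monomial, lp.coeFn_single]

theorem norm_monomial (n : ℕ) (η : E) : ‖monomial n η‖ = ‖η‖ := by
  rw [HardySpace.norm_def, taylor_monomial, lp.norm_single (by norm_num)]

theorem inner_monomial_left (n : ℕ) (η : E) (f : HardySpace E) :
    inner ℂ (monomial n η) f = inner ℂ η (f.coeff n) := by
  rw [HardySpace.inner_def, taylor_monomial, lp.inner_single_left, HardySpace.taylor_apply]

theorem Tz_pow_monomial (n k : ℕ) (η : E) : (Tz E ^ n) (monomial k η) = monomial (k + n) η := by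
  induction n with
  | zero => rfl
  | succ n ih =>
    rw [pow_succ', mul_apply_eq_comp, ih]
    ext z
    rw [Tz_apply, monomial_apply, monomial_apply, smul_smul, ← pow_succ', add_assoc]

theorem hasSum_monomial (f : HardySpace E) : HasSum (fun n => monomial n (f.coeff n)) f := by
  have h := (lp.hasSum_single (p := 2) (by norm_num) (HardySpace.taylor E f)).map
    (HardySpace.taylorIsometry E).symm (HardySpace.taylorIsometry E).symm.continuous
  have e : ∀ g, (HardySpace.taylorIsometry E).symm (HardySpace.taylor E g) = g :=
    (HardySpace.taylorIsometry E).symm_apply_apply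
  rw [e] at h
  convert h using 1
  funext n
  rw [Function.comp_apply, HardySpace.taylor_apply, ← taylor_monomial, e]

theorem norm_Tz_le : ‖Tz E‖ ≤ 1 := LinearMap.mkContinuous_norm_le _ zero_le_one _

theorem norm_Tz_pow_apply_le (n : ℕ) (f : HardySpace E) : ‖(Tz E ^ n) f‖ ≤ ‖f‖ := by
  induction n with
  | zero => rfl
  | succ n ih =>
    rw [pow_succ', mul_apply_eq_comp]
    exact ((Tz E).le_of_opNorm_le norm_Tz_le _).trans (by rwa [one_mul])

variable {Θ : ℂ → E →L[ℂ] E}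

/-- The distance from `zⁿ η` to `Θ H²` is controlled by the tail of `∑ ‖Θₖ* η‖²`. -/
theorem IsInner.exists_mem_rangeMul_norm_sub_sq (hΘ : IsInner Θ) (n : ℕ) (η : E) :
    ∃ g ∈ rangeMul Θ, ‖monomial n η - g‖ ^ 2 = ‖η‖ ^ 2 -
      ∑ k ∈ Finset.range (n + 1), ‖ContinuousLinearMap.adjoint (operatorCoeff Θ k) η‖ ^ 2 := by
  -- These are the coefficients of the analytic part of `Θ* zⁿ η`, the natural candidate for the
  -- best approximation.
  set ξ : ℕ → E := fun j => ContinuousLinearMap.adjoint (operatorCoeff Θ (n - j)) η with hξ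
  have hp := IsTaylor.sum (Finset.range (n + 1)) fun j _ => isTaylor_single j (ξ j)
  have hg := IsTaylor.sum (Finset.range (n + 1)) fun j _ => IsTaylor.pow_smul
    (f := fun z : 𝔻 => Θ z (ξ j)) ⟨hΘ.toIsHInfty.summable_norm_sq_apply (ξ j),
      fun z => hΘ.toIsHInfty.hasSum_apply (ξ j) z z.norm_lt_one⟩ j
  let p : HardySpace E := ⟨_, _, hp⟩
  let g : HardySpace E := ⟨_, _, hg⟩
  have hgp : ∀ z : 𝔻, g z = Θ z (∑ j ∈ Finset.range (n + 1), (z : ℂ) ^ j • ξ j) := fun z => by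
    simp [g, map_sum]
  have hpz : ∀ z : 𝔻, p z = ∑ j ∈ Finset.range (n + 1), (z : ℂ) ^ j • ξ j := fun z => by
    simp [p]
  have hnorm : ‖g‖ = ‖p‖ := hΘ.norm_eq_of_forall_apply
    (p := fun z : ℂ => ∑ j ∈ Finset.range (n + 1), z ^ j • ξ j) (by fun_prop) hpz hgp
  have hrefl : ∑ j ∈ Finset.range (n + 1), ‖ξ j‖ ^ 2 =
      ∑ k ∈ Finset.range (n + 1), ‖ContinuousLinearMap.adjoint (operatorCoeff Θ k) η‖ ^ 2 := by
    rw [← Finset.sum_range_reflect]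
    refine Finset.sum_congr rfl fun j hj => ?_
    have : n - (n + 1 - 1 - j) = j := by
      have := Finset.mem_range.1 hj
      omega
    simp only [hξ, this]
  have hpn : ‖p‖ ^ 2 = ∑ j ∈ Finset.range (n + 1), ‖ξ j‖ ^ 2 := by
    have hc : ∀ k, (∑ j ∈ Finset.range (n + 1), (Pi.single j (ξ j) : ℕ → E)) k =
        if k ∈ Finset.range (n + 1) then ξ k else 0 := fun k => by
      rw [Finset.sum_apply, Finset.sum_pi_single]
    rw [HardySpace.norm_sq_of_isTaylor hp, tsum_eq_sum (s := Finset.range (n + 1)) fun k hk => by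
      rw [hc, if_neg hk, norm_zero, zero_pow two_ne_zero]]
    refine Finset.sum_congr rfl fun k hk => ?_
    rw [hc, if_pos hk]
  -- Only the `n`-th coefficient `∑_j Θ_{n-j} ξ_j` of `g` is seen, and moving each `Θ_{n-j}` onto
  -- `η` gives back `ξ_j`.
  have hin : inner ℂ (monomial n η) g = ((∑ j ∈ Finset.range (n + 1), ‖ξ j‖ ^ 2 : ℝ) : ℂ) := by
    rw [inner_monomial_left, g.isTaylor_coeff.unique hg, Finset.sum_apply, inner_sum,
      Complex.ofReal_sum]
    refine Finset.sum_congr rfl fun j hj => ?_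
    rw [if_pos (Finset.mem_range_succ_iff.1 hj), ← ContinuousLinearMap.adjoint_inner_left,
      inner_self_eq_norm_sq_to_K]
    push_cast
    rfl
  refine ⟨g, ⟨p, fun z => by rw [hgp, hpz]⟩, ?_⟩
  rw [norm_sub_sq (𝕜 := ℂ), hin, hnorm, hpn, norm_monomial, hrefl]
  simp only [RCLike.re_to_complex, Complex.ofReal_re]
  ring

/-- The projection kills `Θ H²`, which lies in its double orthogonal complement; closedness of `Θ
H²` plays no role. -/
theorem norm_orthogonalProjectionOnto_modelSpace_le (f : HardySpace E) {g : HardySpace E}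
    (hg : g ∈ rangeMul Θ) : ‖(modelSpace Θ).orthogonalProjectionOnto f‖ ≤ ‖f - g‖ := by
  have h0 : (modelSpace Θ).orthogonalProjectionOnto g = 0 :=
    Submodule.orthogonalProjectionOnto_eq_zero_iff.2 (Submodule.le_orthogonal_orthogonal _ hg)
  rw [← sub_zero ((modelSpace Θ).orthogonalProjectionOnto f), ← h0, ← map_sub]
  exact Submodule.norm_orthogonalProjectionOnto_apply_le _ _

theorem IsInner.tendsto_projection_monomial (hΘ : IsInner Θ)
    (hinv : ∀ᵐ θ : ℝ, ∃ U : E →L[ℂ] E,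
      HasBoundaryValue Θ (Complex.exp (θ * Complex.I)) U ∧ IsUnit U) (η : E) :
    Filter.Tendsto (fun n => (modelSpace Θ).orthogonalProjectionOnto (monomial n η))
      Filter.atTop (𝓝 0) := by
  have hsum := (hΘ.toIsHInfty.summable_norm_sq_adjoint_apply η).hasSum.tendsto_sum_nat
  -- Replacing `‖η‖²` by the full series turns the distance formula into a tail bound.
  have hle := hΘ.norm_sq_le_tsum_adjoint hinv η
  have h1 := ((Filter.tendsto_add_atTop_iff_nat 1).2 hsum).const_sub
    (∑' k, ‖ContinuousLinearMap.adjoint (operatorCoeff Θ k) η‖ ^ 2)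
  rw [sub_self] at h1
  have h2 : Filter.Tendsto
      (fun n => ‖(modelSpace Θ).orthogonalProjectionOnto (monomial n η)‖ ^ 2)
      Filter.atTop (𝓝 0) := by
    refine squeeze_zero (fun n => by positivity) (fun n => ?_) h1
    obtain ⟨g, hg, hng⟩ := hΘ.exists_mem_rangeMul_norm_sub_sq n η
    have := norm_orthogonalProjectionOnto_modelSpace_le (monomial n η) hg
    calc _ ≤ ‖monomial n η - g‖ ^ 2 := by gcongr
      _ ≤ _ := by rw [hng]; gcongr
  rw [tendsto_zero_iff_norm_tendsto_zero]
  simpa [Real.sqrt_sq (norm_nonneg _)] using h2.sqrt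

/-- Linearity handles polynomials; density and contractivity of `P T_zⁿ`, uniform in `n`, handle the
rest. -/
theorem IsInner.tendsto_projection_Tz_pow (hΘ : IsInner Θ)
    (hinv : ∀ᵐ θ : ℝ, ∃ U : E →L[ℂ] E,
      HasBoundaryValue Θ (Complex.exp (θ * Complex.I)) U ∧ IsUnit U) (f : HardySpace E) :
    Filter.Tendsto (fun n => (modelSpace Θ).orthogonalProjectionOnto ((Tz E ^ n) f))
      Filter.atTop (𝓝 0) := by
  set P := (modelSpace Θ).orthogonalProjectionOnto
  rw [Metric.tendsto_atTop]
  intro ε hε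
  obtain ⟨s, hs⟩ := ((Metric.tendsto_nhds.1 (hasSum_monomial f)) (ε / 2) (half_pos hε)).exists
  set g := ∑ k ∈ s, monomial k (f.coeff k)
  have hg : Filter.Tendsto (fun n => P ((Tz E ^ n) g)) Filter.atTop (𝓝 0) := by
    simp only [g, map_sum, Tz_pow_monomial]
    rw [← Finset.sum_const_zero (ι := ℕ) (s := s)]
    refine tendsto_finsetSum s fun k _ => ?_
    exact (hΘ.tendsto_projection_monomial hinv (f.coeff k)).comp
      (Filter.tendsto_atTop_mono (fun n => Nat.le_add_left n k) Filter.tendsto_id)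
  obtain ⟨N, hN⟩ := (Metric.tendsto_atTop.1 hg) (ε / 2) (half_pos hε)
  refine ⟨N, fun n hn => ?_⟩
  have h1 := hN n hn
  rw [dist_zero_right] at h1 ⊢
  rw [dist_comm, dist_eq_norm] at hs
  calc ‖P ((Tz E ^ n) f)‖ = ‖P ((Tz E ^ n) (f - g)) + P ((Tz E ^ n) g)‖ := by
        rw [← map_add, ← map_add, sub_add_cancel]
    _ ≤ ‖f - g‖ + ‖P ((Tz E ^ n) g)‖ := (norm_add_le _ _).trans (by
        gcongr
        exact (Submodule.norm_orthogonalProjectionOnto_apply_le _ _).trans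
          (norm_Tz_pow_apply_le n _))
    _ < ε := by linarith

theorem Tz_mem_rangeMul {g : HardySpace E} (hg : g ∈ rangeMul Θ) : Tz E g ∈ rangeMul Θ := by
  obtain ⟨f, hf⟩ := hg
  exact ⟨Tz E f, fun z => by rw [Tz_apply, Tz_apply, hf, map_smul]⟩

theorem adjoint_Tz_mem_modelSpace {q : HardySpace E} (hq : q ∈ modelSpace Θ) :
    ContinuousLinearMap.adjoint (Tz E) q ∈ modelSpace Θ := fun g hg => by
  rw [ContinuousLinearMap.adjoint_inner_right]
  exact hq _ (Tz_mem_rangeMul hg)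

/-- The model space is invariant under `T_z*`, so moving `T_z` across the inner product keeps the
test vector `q` inside it, where the projection is invisible. -/
theorem modelOperator_projection (f : HardySpace E) :
    modelOperator Θ ((modelSpace Θ).orthogonalProjectionOnto f) =
      (modelSpace Θ).orthogonalProjectionOnto (Tz E f) := by
  refine ext_inner_left ℂ fun q => ?_
  rw [modelOperator, ContinuousLinearMap.comp_apply, ContinuousLinearMap.comp_apply,
    Submodule.inner_orthogonalProjectionOnto_eq_of_mem_left,
    Submodule.inner_orthogonalProjectionOnto_eq_of_mem_left,
    ← ContinuousLinearMap.adjoint_inner_left (Tz E) _ (q : HardySpace E),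
    ← ContinuousLinearMap.adjoint_inner_left (Tz E) _ (q : HardySpace E)]
  exact (Submodule.inner_orthogonalProjectionOnto_eq_of_mem_left
    (⟨_, adjoint_Tz_mem_modelSpace q.2⟩ : modelSpace Θ) f)

theorem modelOperator_pow_apply (n : ℕ) (x : modelSpace Θ) :
    (modelOperator Θ ^ n) x = (modelSpace Θ).orthogonalProjectionOnto ((Tz E ^ n) x) := by
  induction n with
  | zero => exact (Submodule.orthogonalProjectionOnto_mem_subspace_eq_self x).symm
  | succ n ih =>
    rw [pow_succ', mul_apply_eq_comp, ih, modelOperator_projection, pow_succ', mul_apply_eq_comp]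

/-- The model operator of a two-sided inner function is strongly stable. -/
theorem IsInner.tendsto_modelOperator_pow (hΘ : IsInner Θ)
    (hinv : ∀ᵐ θ : ℝ, ∃ U : E →L[ℂ] E,
      HasBoundaryValue Θ (Complex.exp (θ * Complex.I)) U ∧ IsUnit U) (x : modelSpace Θ) :
    Filter.Tendsto (fun n => (modelOperator Θ ^ n) x) Filter.atTop (𝓝 0) := by
  simpa only [modelOperator_pow_apply] using hΘ.tendsto_projection_Tz_pow hinv x

end Stability

/-! ### Strongly stable operators and the equation `S* T S = T`. -/

section StronglyStable

variable {H : Type*} [NormedAddCommGroup H] [InnerProductSpace ℂ H] [CompleteSpace H]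

/-- A strongly stable operator `S` admits no nonzero `T` with `S* T S = T`. -/
theorem eq_zero_of_adjoint_comp_comp_eq {S T : H →L[ℂ] H}
    (hS : ∀ x, Filter.Tendsto (fun n => (S ^ n) x) Filter.atTop (𝓝 0))
    (h : ContinuousLinearMap.adjoint S ∘L T ∘L S = T) : T = 0 := by
  have hpow : ∀ n x y, inner ℂ x (T y) = inner ℂ ((S ^ n) x) (T ((S ^ n) y)) := by
    intro n
    induction n with
    | zero => exact fun x y => rfl
    | succ n ih =>
      intro x y
      rw [ih, pow_succ', mul_apply_eq_comp, mul_apply_eq_comp]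
      nth_rw 1 [← h]
      exact ContinuousLinearMap.adjoint_inner_right S _ _
  refine ContinuousLinearMap.ext fun y => ext_inner_left ℂ fun x => ?_
  have h1 : Filter.Tendsto (fun n => inner ℂ ((S ^ n) x) (T ((S ^ n) y))) Filter.atTop
      (𝓝 (inner ℂ (0 : H) (T 0))) := (hS x).inner ((T.continuous.tendsto 0).comp (hS y))
  simp only [← hpow, inner_zero_left] at h1
  rw [tendsto_nhds_unique tendsto_const_nhds h1]
  simp

end StronglyStable

end ModelSpace

end

theorem proposition5p4 {E : Type*} [NormedAddCommGroup E] [InnerProductSpace ℂ E]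
    [CompleteSpace E] (Θ : ℂ → E →L[ℂ] E) (hΘ : ModelSpace.IsInner Θ)
    (hinv : ∀ᵐ θ : ℝ, ∃ U : E →L[ℂ] E,
      ModelSpace.HasBoundaryValue Θ (Complex.exp (θ * Complex.I)) U ∧ IsUnit U)
    (T : ModelSpace.modelSpace Θ →L[ℂ] ModelSpace.modelSpace Θ) :
    ContinuousLinearMap.adjoint (ModelSpace.modelOperator Θ) ∘L T ∘L
        ModelSpace.modelOperator Θ = T ↔ T = 0 := by
  refine ⟨ModelSpace.eq_zero_of_adjoint_comp_comp_eq (hΘ.tendsto_modelOperator_pow hinv), ?_⟩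
  rintro rfl
  rw [ContinuousLinearMap.zero_comp, ContinuousLinearMap.comp_zero]
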